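/- Theorem 1.11. For a topological space $X$ let $\lambda_p$ be the family of all subspaces $T\subseteq X$ that have a dense $\sigma$-pseudocompact subspace, i.e. a subspace $D\subseteq T$ dense in $T$ which is a countable union of pseudocompact subspaces (a subspace is pseudocompact if every continuous real-valued function on it is bounded). For a non-closed set $A\subseteq X$ and a point $x\in\overline{A}\setminus A$, consider the following game with steps $n\in\mathbb{N}$. At the $n$-th step player ONE chooses a neighborhood $V_n$ of $x$, and then player TWO chooses a set $S_n\subseteq A$ such that $S_n\subseteq\overline{T_n}$ for some $T_n\in\lambda_p$. Player TWO wins if $\overline{\bigcup_n S_n}\cap\bigcap_n V_n\neq\emptyset$; otherwise player ONE wins. The space $X$ is called an $AV_{\lambda_p}$-space if for every non-closed $A\subseteq X$ there is a point $x\in\overline{A}\setminus A$ for which player TWO has a winning strategy in this game. A topological space $Z$ is called countably pracompact if it has a dense subset $Y$ such that every infinite subset of $Y$ has a limit point in $Z$. Let $C_p(X)$ be the space of continuous functions $X\to\mathbb{R}$ with the topology of pointwise convergence. Let $X$ be a Tychonoff $AV_{\lambda_p}$-space. Then every countably pracompact subspace of $C_p(X)$ is relatively compact, i.e. its closure in $C_p(X)$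 is compact. -/

import Mathlib

open Set Filter Topology

/-- A subset `A` of a topological space is pseudocompact if every continuous real-valued function
on the subspace `A` is bounded. -/
def IsPseudocompact {X : Type*} [TopologicalSpace X] (A : Set X) : Prop :=
  ∀ f : A → ℝ, Continuous f → Bornology.IsBounded (range f)

/-- A subset is σ-pseudocompact if it is the union of countably many pseudocompact subspaces.
(The empty set is pseudocompact, so sequences also cover finite and empty unions.) -/
def IsSigmaPseudocompact {X : Type*} [TopologicalSpace X] (A : Set X) : Prop :=
  ∃ K : ℕ → Set X, (∀ n, IsPseudocompact (K n)) ∧ A = ⋃ n, K n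

/-- The family `λ_p` of all subspaces of `X` that have a dense σ-pseudocompact subspace. -/
def lambdaP (X : Type*) [TopologicalSpace X] : Set (Set X) :=
  {T | ∃ D : Set X, D ⊆ T ∧ T ⊆ closure D ∧ IsSigmaPseudocompact D}

/-- A topological space `Z` is countably pracompact if it has a dense subset `Y` such that every
infinite subset of `Y` has a limit (accumulation) point in `Z`. -/
def IsCountablyPracompactSpace (Z : Type*) [TopologicalSpace Z] : Prop :=
  ∃ Y : Set Z, Dense Y ∧ ∀ A : Set Z, A ⊆ Y → A.Infinite → ∃ z : Z, AccPt z (𝓟 A)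

/-- A strategy for player TWO: it answers the finite list `[V 0, …, V n]` of the moves
that player ONE has made so far by a subset of `X`. -/
abbrev AVStrategy (X : Type*) : Type _ := List (Set X) → Set X

/-- The `n`-th answer (steps are numbered from `0`) of player TWO following the strategy `σ`
against the moves `V 0, V 1, …` of player ONE; it depends only on `V 0, …, V n`. -/
def AVStrategy.answer {X : Type*} (σ : AVStrategy X) (V : ℕ → Set X) (n : ℕ) : Set X :=
  σ (List.ofFn fun i : Fin (n + 1) => V i)

/-- The strategy `σ` is winning for player TWO in the Asanov–Velichko game generated by the
family `L`, played on the set `A` at the point `x`: against all sequences of (open) neighborhoods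
`V n` of `x` chosen by player ONE, the answers `S n` of `σ` are legal (`S n ⊆ A`, and `S n` lies in
the closure of some member of `L`), and the closure of `⋃ n, S n` meets `⋂ n, V n`. -/
def AVStrategy.IsWinning {X : Type*} [TopologicalSpace X] (L : Set (Set X)) (A : Set X) (x : X)
    (σ : AVStrategy X) : Prop :=
  ∀ V : ℕ → Set X, (∀ n, IsOpen (V n) ∧ x ∈ V n) →
    (∀ n, σ.answer V n ⊆ A ∧ ∃ T ∈ L, σ.answer V n ⊆ closure T) ∧
    (closure (⋃ n, σ.answer V n) ∩ ⋂ n, V n).Nonempty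

/-- `X` is an `AV_L`-space (Asanov–Velichko generated by the family `L`). -/
def IsAVSpace (X : Type*) [TopologicalSpace X] (L : Set (Set X)) : Prop :=
  ∀ A : Set X, ¬ IsClosed A →
    ∃ x ∈ closure A \ A, ∃ σ : AVStrategy X, σ.IsWinning L A x

/-- `C_p(X)`: the continuous real-valued functions on `X` with the topology of pointwise
convergence, i.e. the subspace topology inherited from the product `X → ℝ`. -/
abbrev Cp (X : Type*) [TopologicalSpace X] : Type _ := {f : X → ℝ // Continuous f}

/-! Let `𝒴` be the dense part of `F`, viewed in `X → ℝ`. Its sequences have continuous cluster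
points, so it is pointwise bounded and its closure in the product is compact; it remains to see that
each `g` in that closure is continuous. Two facts carry this. On a σ-pseudocompact set, `g` agrees
with a continuous cluster point of some sequence in `𝒴` (`exists_mapClusterPt_eqOn`). If `g ⁻¹' K`
were not closed, let ONE play neighborhoods on which countably many functions of `𝒴`, approximating
`g` on σ-pseudocompact sets behind TWO's answers, are nearly constant. Those functions, hence their
cluster point `φ`, take equal values at `x` and at the point `y` won by TWO; since `φ = g` at `x`
and on the answers, `g x = φ y ∈ K`, which is absurd. -/

/-- The set `𝒴` approximates `g` pointwise on finite subsets of `D`. -/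
def ApproximatesOn {X : Type*} (𝒴 : Set (X → ℝ)) (g : X → ℝ) (D : Set X) : Prop :=
  ∀ s : Set X, s.Finite → s ⊆ D → ∀ ε > 0, ∃ f ∈ 𝒴, ∀ x ∈ s, |f x - g x| < ε

/-- Every sequence in `𝒴` has a continuous pointwise cluster point. -/
def HasContinuousClusterPts {X : Type*} [TopologicalSpace X] (𝒴 : Set (X → ℝ)) : Prop :=
  ∀ h : ℕ → X → ℝ, (∀ k, h k ∈ 𝒴) → ∃ φ, Continuous φ ∧ MapClusterPt φ atTop h

theorem HasContinuousClusterPts.mono {X : Type*} [TopologicalSpace X] {𝒴 𝒵 : Set (X → ℝ)}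
    (h : HasContinuousClusterPts 𝒵) (hs : 𝒴 ⊆ 𝒵) : HasContinuousClusterPts 𝒴 :=
  fun u hu => h u fun k => hs (hu k)

theorem isOpen_setOf_forall_abs_sub_lt {X : Type*} (g : X → ℝ) {s : Set X} (hs : s.Finite)
    (ε : ℝ) : IsOpen {f : X → ℝ | ∀ x ∈ s, |f x - g x| < ε} := by
  have : {f : X → ℝ | ∀ x ∈ s, |f x - g x| < ε} = ⋂ x ∈ s, {f : X → ℝ | |f x - g x| < ε} := by
    ext f; simp
  rw [this]
  exact hs.isOpen_biInter fun x _ =>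
    isOpen_lt ((continuous_apply x).sub continuous_const).abs continuous_const

theorem approximatesOn_of_mem_closure {X : Type*} {𝒴 : Set (X → ℝ)} {g : X → ℝ}
    (hg : g ∈ closure 𝒴) (D : Set X) : ApproximatesOn 𝒴 g D := by
  intro s hs _ ε hε
  obtain ⟨f, hf, hfY⟩ := mem_closure_iff.1 hg _ (isOpen_setOf_forall_abs_sub_lt g hs ε)
    (by simpa using fun _ _ => hε)
  exact ⟨f, hfY, hf⟩

theorem approximatesOn_range_of_mapClusterPt {X : Type*} {h : ℕ → X → ℝ} {φ g : X → ℝ}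
    {D : Set X} (hφ : MapClusterPt φ atTop h) (hg : EqOn φ g D) :
    ApproximatesOn (range h) g D := by
  intro s hs hsD ε hε
  obtain ⟨n, hn⟩ := (hφ.frequently ((isOpen_setOf_forall_abs_sub_lt φ hs ε).mem_nhds
    (by simpa using fun _ _ => hε))).exists
  exact ⟨h n, mem_range_self n, fun x hx => by rw [← hg (hsD hx)]; exact hn x hx⟩

/-- Recursive choice where the choice at step `n` may refer to the earlier values. -/
theorem exists_seq_of_forall_dependent {α : Type*} [Nonempty α] (R : ℕ → (ℕ → α) → α → Prop)
    (hex : ∀ n u, ∃ a, R n u a)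
    (hcongr : ∀ n u v a, (∀ i < n, u i = v i) → R n u a → R n v a) :
    ∃ v : ℕ → α, ∀ n, R n v (v n) := by
  classical
  choose c hc using hex
  -- The arbitrary value fills indices `≥ n`, which `hcongr` makes irrelevant.
  let F : ∀ n, (∀ m, m < n → α) → α := fun n ih =>
    c n fun i => if hi : i < n then ih i hi else Classical.arbitrary α
  let v : ℕ → α := fun n => Nat.strongRec (motive := fun _ => α) F n
  have hv : ∀ n, v n = c n fun i => if i < n then v i else Classical.arbitrary α := by
    intro n
    have : v n = F n fun m _ => v m := by
      simp only [v]
      rw [Nat.strongRec]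
    rw [this]
    simp only [F, dite_eq_ite]
  refine ⟨v, fun n => ?_⟩
  have := hc n fun i => if i < n then v i else Classical.arbitrary α
  rw [← hv n] at this
  exact hcongr _ _ _ _ (fun i hi => by simp [hi]) this

/-! ### Pseudocompact and σ-pseudocompact sets -/

theorem IsPseudocompact.singleton {X : Type*} [TopologicalSpace X] (x : X) :
    IsPseudocompact ({x} : Set X) := fun f _ => (finite_range f).isBounded

theorem IsPseudocompact.empty {X : Type*} [TopologicalSpace X] :
    IsPseudocompact (∅ : Set X) := fun f _ => (finite_range f).isBounded

theorem IsSigmaPseudocompact.empty {X : Type*} [TopologicalSpace X] :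
    IsSigmaPseudocompact (∅ : Set X) := ⟨fun _ => ∅, fun _ => .empty, by simp⟩

theorem IsSigmaPseudocompact.singleton {X : Type*} [TopologicalSpace X] (x : X) :
    IsSigmaPseudocompact ({x} : Set X) :=
  ⟨fun _ => {x}, fun _ => .singleton x, (iUnion_const _).symm⟩

theorem IsSigmaPseudocompact.iUnion {X ι : Type*} [TopologicalSpace X] [Countable ι]
    {A : ι → Set X} (hA : ∀ i, IsSigmaPseudocompact (A i)) :
    IsSigmaPseudocompact (⋃ i, A i) := by
  rcases isEmpty_or_nonempty ι with hι | hι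
  · simpa using IsSigmaPseudocompact.empty
  choose K hK hAK using hA
  obtain ⟨e, he⟩ := exists_surjective_nat (ι × ℕ)
  refine ⟨fun n => K (e n).1 (e n).2, fun n => hK _ _, ?_⟩
  rw [he.iUnion_comp (fun p : ι × ℕ => K p.1 p.2), iUnion_prod']
  exact iUnion_congr hAK

theorem IsSigmaPseudocompact.union {X : Type*} [TopologicalSpace X] {A B : Set X}
    (hA : IsSigmaPseudocompact A) (hB : IsSigmaPseudocompact B) :
    IsSigmaPseudocompact (A ∪ B) := by
  rw [union_eq_iUnion]
  exact .iUnion fun b => by cases b <;> assumption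

/-- On a pseudocompact set, values of countably many continuous functions along a sequence
cluster at their values at some point of the set. -/
theorem IsPseudocompact.exists_mapClusterPt {X : Type*} [TopologicalSpace X] {P : Set X}
    (hP : IsPseudocompact P) {u : ℕ → X → ℝ} (hu : ∀ i, Continuous (u i)) {c : ℕ → X}
    (hc : ∀ j, c j ∈ P) :
    ∃ q ∈ P, MapClusterPt (fun i => u i q) atTop fun j i => u i (c j) := by
  have hb : ∀ i, ∃ r, ∀ p ∈ P, u i p ∈ Metric.closedBall (0 : ℝ) r := by
    intro i
    obtain ⟨r, hr⟩ := (hP (fun p => u i p) ((hu i).comp continuous_subtype_val)).subset_closedBall 0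
    exact ⟨r, fun p hp => hr ⟨⟨p, hp⟩, rfl⟩⟩
  choose r hr using hb
  have hcomp : IsCompact (pi univ fun i => Metric.closedBall (0 : ℝ) (r i)) :=
    isCompact_univ_pi fun i => isCompact_closedBall _ _
  obtain ⟨z, -, hz⟩ := hcomp.exists_mapClusterPt (f := atTop)
    (u := fun (j : ℕ) i => u i (c j))
    (tendsto_principal.2 (.of_forall fun j i _ => hr i _ (hc j)))
  let _ : MetricSpace (ℕ → ℝ) := TopologicalSpace.metrizableSpaceMetric (ℕ → ℝ)
  by_cases hq : ∃ q ∈ P, (fun i => u i q) = z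
  · obtain ⟨q, hqP, rfl⟩ := hq
    exact ⟨q, hqP, hz⟩
  push Not at hq
  -- If `z` is not attained on `P`, the inverse distance to `z` is continuous on `P` but unbounded
  -- along `c`.
  have hcont : Continuous fun p : P => (dist (fun i => u i (p : X)) z)⁻¹ := by
    refine Continuous.inv₀ (Continuous.dist ?_ continuous_const) fun p =>
      dist_ne_zero.2 (hq p p.2)
    exact continuous_pi fun i => (hu i).comp continuous_subtype_val
  obtain ⟨M, hM⟩ := (hP _ hcont).subset_closedBall 0
  have hM' : ∀ p ∈ P, (dist (fun i => u i p) z)⁻¹ ≤ M := fun p hp => by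
    have := hM ⟨⟨p, hp⟩, rfl⟩
    rw [mem_closedBall_zero_iff] at this
    exact (le_abs_self _).trans this
  have hpos : 0 < M := (inv_pos.2 (dist_pos.2 (hq _ (hc 0)))).trans_le (hM' _ (hc 0))
  obtain ⟨j, hj⟩ := (hz.frequently (Metric.ball_mem_nhds z (inv_pos.2 hpos))).exists
  have h1 : M < (dist (fun i => u i (c j)) z)⁻¹ := by
    rw [lt_inv_comm₀ hpos (dist_pos.2 (hq _ (hc j)))]
    exact hj
  exact absurd (hM' _ (hc j)) (not_le.2 h1)

/-- A σ-pseudocompact union contains a sequence that is dense in each piece with respect to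
finitely many functions. -/
theorem exists_seq_dense_pieces {X : Type*} {P : ℕ → Set X} (hne : (⋃ m, P m).Nonempty)
    (l : List (X → ℝ)) :
    ∃ c : ℕ → X, (∀ j, c j ∈ ⋃ m, P m) ∧ ∀ m, ∀ p ∈ P m, ∀ ε > 0,
      ∃ j, c j ∈ P m ∧ ∀ u ∈ l, |u (c j) - u p| < ε := by
  let E : X → (Fin l.length → ℝ) := fun x i => l.get i x
  obtain ⟨x₀, hx₀⟩ := hne
  have : Nonempty X := ⟨x₀⟩
  -- No topology on `X` is needed: subsets of the finite power of `ℝ` are separable.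
  have h : ∀ m, ∃ t ⊆ P m, t.Countable ∧ E '' P m ⊆ closure (E '' t) := by
    intro m
    obtain ⟨s, hs, hsc, hsd⟩ :=
      (TopologicalSpace.IsSeparable.of_separableSpace (E '' P m)).exists_countable_dense_subset
    have hs' : ∀ y ∈ s, ∃ x, x ∈ P m ∧ E x = y := fun y hy => hs hy
    choose! a haP haE using hs'
    exact ⟨a '' s, image_subset_iff.2 fun y hy => haP y hy, hsc.image a,
      hsd.trans (closure_mono fun y hy => ⟨a y, mem_image_of_mem a hy, haE y hy⟩)⟩
  choose t ht htc htd using h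
  obtain ⟨c, hc⟩ := ((countable_iUnion htc).insert x₀).exists_eq_range (insert_nonempty _ _)
  refine ⟨c, fun j => ?_, fun m p hp ε hε => ?_⟩
  · have : c j ∈ insert x₀ (⋃ m, t m) := hc ▸ mem_range_self j
    rcases this with h | h
    · rwa [h]
    · exact iUnion_mono ht h
  · obtain ⟨_, ⟨a, hat, rfl⟩, ha⟩ := Metric.mem_closure_iff.1 (htd m ⟨p, hp, rfl⟩) ε hε
    have : a ∈ range c := hc ▸ mem_insert_of_mem _ (mem_iUnion.2 ⟨m, hat⟩)
    obtain ⟨j, rfl⟩ := this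
    refine ⟨j, ht m hat, fun u hu => ?_⟩
    obtain ⟨i, rfl⟩ := List.get_of_mem hu
    have := (dist_pi_lt_iff hε).1 ha i
    rwa [dist_comm, Real.dist_eq] at this

/-- Two points not separated by a sequence of functions are not separated by a cluster point. -/
theorem MapClusterPt.apply_eq_of_forall {X : Type*} {h : ℕ → X → ℝ} {φ : X → ℝ}
    (hφ : MapClusterPt φ atTop h) {p q : X} (hpq : ∀ i, h i p = h i q) : φ p = φ q := by
  have hcl : IsClosed {f : X → ℝ | f p = f q} :=
    isClosed_eq (continuous_apply p) (continuous_apply q)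
  by_contra hne
  obtain ⟨i, hi⟩ := (hφ.frequently (hcl.isOpen_compl.mem_nhds hne)).exists
  exact hi (hpq i)

theorem MapClusterPt.eq_of_tendsto {α Y : Type*} [TopologicalSpace Y] [T2Space Y]
    {l : Filter α} {u : α → Y} {a b : Y} (ha : MapClusterPt a l u) (hb : Tendsto u l (𝓝 b)) :
    a = b := by
  by_contra hab
  exact (ha.clusterPt.mono hb).ne (disjoint_iff.1 (disjoint_nhds_nhds.2 hab))

/-- If a family with continuous cluster points approximates `g` pointwise on a nonempty
σ-pseudocompact set, then some continuous cluster point of a sequence in the family agrees with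
`g` there. -/
theorem exists_mapClusterPt_eqOn {X : Type*} [TopologicalSpace X] {𝒴 : Set (X → ℝ)}
    (h𝒴 : HasContinuousClusterPts 𝒴) (hcont : ∀ f ∈ 𝒴, Continuous f) {D : Set X}
    (hD : IsSigmaPseudocompact D) (hne : D.Nonempty) {g : X → ℝ} (hg : ApproximatesOn 𝒴 g D) :
    ∃ (h : ℕ → X → ℝ) (φ : X → ℝ), (∀ k, h k ∈ 𝒴) ∧ Continuous φ ∧
      MapClusterPt φ atTop h ∧ EqOn φ g D := by
  obtain ⟨P, hP, rfl⟩ := hD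
  -- Putting `g` in the list makes the chosen points track its values although `g` may be
  -- discontinuous.
  choose C hCD hC using fun l : List (X → ℝ) => exists_seq_dense_pieces hne (g :: l)
  let L : (ℕ → X → ℝ) → ℕ → List (X → ℝ) := fun u n => (List.range n).map u
  have hL : ∀ {u v : ℕ → X → ℝ} {n : ℕ}, (∀ i < n, u i = v i) → L u n = L v n :=
    fun huv => List.map_congr_left fun i hi => huv i (List.mem_range.1 hi)
  -- Bookkeeping: `h n` approximates `g` on initial segments of the sequences chosen for `h 0, …, h
  -- (i - 1)`, `i ≤ n`, so `φ = g` on all of them.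
  obtain ⟨h, hh⟩ := exists_seq_of_forall_dependent
    (fun n (u : ℕ → X → ℝ) f => f ∈ 𝒴 ∧ ∀ i ≤ n, ∀ j ≤ n,
      |f (C (L u i) j) - g (C (L u i) j)| < 1 / ((n : ℝ) + 1))
    (by
      intro n u
      obtain ⟨f, hf, hfg⟩ := hg
        ((fun p : ℕ × ℕ => C (L u p.1) p.2) '' (Iic n ×ˢ Iic n))
        (((finite_Iic n).prod (finite_Iic n)).image _)
        (by rintro _ ⟨p, -, rfl⟩; exact hCD _ _) (1 / ((n : ℝ) + 1)) (by positivity)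
      exact ⟨f, hf, fun i hi j hj => hfg _ ⟨(i, j), ⟨hi, hj⟩, rfl⟩⟩)
    (by
      rintro n u v f huv ⟨hf, hfg⟩
      refine ⟨hf, fun i hi => ?_⟩
      rw [← hL fun k hk => huv k (hk.trans_le hi)]
      exact hfg i hi)
  obtain ⟨φ, hφc, hφ⟩ := h𝒴 h fun k => (hh k).1
  refine ⟨h, φ, fun k => (hh k).1, hφc, hφ, ?_⟩
  have hφC : ∀ i j, φ (C (L h i) j) = g (C (L h i) j) := by
    intro i j
    refine (hφ.continuousAt_comp (continuous_apply (C (L h i) j)).continuousAt).eq_of_tendsto ?_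
    rw [tendsto_iff_dist_tendsto_zero]
    refine squeeze_zero' (.of_forall fun _ => dist_nonneg) ?_
      tendsto_one_div_add_atTop_nhds_zero_nat
    filter_upwards [eventually_ge_atTop i, eventually_ge_atTop j] with n hi hj
    exact ((hh n).2 i hi j hj).le
  intro p hp
  obtain ⟨m, hpm⟩ := mem_iUnion.1 hp
  choose e heP he using fun k : ℕ => hC (L h k) m p hpm (1 / ((k : ℝ) + 1)) (by positivity)
  have hlim : ∀ u : X → ℝ, (∀ᶠ k in atTop, u ∈ g :: L h k) →
      Tendsto (fun k => u (C (L h k) (e k))) atTop (𝓝 (u p)) := by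
    intro u hu
    rw [tendsto_iff_dist_tendsto_zero]
    refine squeeze_zero' (.of_forall fun _ => dist_nonneg) ?_
      tendsto_one_div_add_atTop_nhds_zero_nat
    filter_upwards [hu] with k hk
    exact (he k u hk).le
  -- The chosen points approach `p` for `g` and every `h i`, and pseudocompactness yields `q` with
  -- `h i q = h i p` and `φ q = g p`. Index `0` holds `φ`.
  obtain ⟨q, -, hq⟩ := (hP m).exists_mapClusterPt
    (u := fun i => Nat.casesOn i φ h)
    (by rintro (_ | i); exacts [hφc, hcont _ (hh i).1]) heP
  have hq' := fun i => hq.continuousAt_comp (continuous_apply i).continuousAt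
  have hhq : ∀ i, h i q = h i p := fun i => (hq' (i + 1)).eq_of_tendsto <| hlim (h i) <| by
    filter_upwards [eventually_gt_atTop i] with k hk
    exact List.mem_cons_of_mem _ (List.mem_map_of_mem (List.mem_range.2 hk))
  have hφq : φ q = g p := (hq' 0).eq_of_tendsto <|
    (hlim g (.of_forall fun _ => List.mem_cons_self)).congr fun k => (hφC k (e k)).symm
  rw [← hφq]
  exact (hφ.apply_eq_of_forall hhq).symm

/-! ### Playing against a winning strategy -/

theorem exists_isSigmaPseudocompact_of_lambdaP {X : Type*} [TopologicalSpace X] {S : Set X}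
    (h : ∃ T ∈ lambdaP X, S ⊆ closure T) :
    ∃ D, IsSigmaPseudocompact D ∧ S ⊆ closure D := by
  obtain ⟨T, ⟨D, -, hTD, hD⟩, hST⟩ := h
  exact ⟨D, hD, hST.trans (closure_minimal hTD isClosed_closure)⟩

/-- A pointwise limit of a family with continuous cluster points cannot be discontinuous along
a set and a point for which player TWO wins. -/
theorem AVStrategy.IsWinning.apply_mem_of_isClosed {X : Type*} [TopologicalSpace X]
    {𝒴 : Set (X → ℝ)} (h𝒴 : HasContinuousClusterPts 𝒴) (hcont : ∀ f ∈ 𝒴, Continuous f)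
    {g : X → ℝ} (hg : ∀ D, ApproximatesOn 𝒴 g D) {K : Set ℝ} (hK : IsClosed K) {x : X}
    {σ : AVStrategy X} (hσ : σ.IsWinning (lambdaP X) (g ⁻¹' K) x) : g x ∈ K := by
  have hDex : ∀ w : List (Set X), ∃ D, IsSigmaPseudocompact D ∧
      ((∃ T ∈ lambdaP X, σ w ⊆ closure T) → σ w ⊆ closure D) := by
    intro w
    by_cases hw : ∃ T ∈ lambdaP X, σ w ⊆ closure T
    · obtain ⟨D, hD, hwD⟩ := exists_isSigmaPseudocompact_of_lambdaP hw
      exact ⟨D, hD, fun _ => hwD⟩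
    · exact ⟨∅, .empty, fun h => absurd h hw⟩
  choose D hD hσD using hDex
  have hηex : ∀ E : Set X, IsSigmaPseudocompact E → E.Nonempty →
      ∃ η : ℕ → X → ℝ, (∀ k, η k ∈ 𝒴) ∧ ApproximatesOn (range η) g E := by
    intro E hE hne
    obtain ⟨η, φ, hη, -, hφ, hφg⟩ := exists_mapClusterPt_eqOn h𝒴 hcont hE hne (hg E)
    exact ⟨η, hη, approximatesOn_range_of_mapClusterPt hφ hφg⟩
  let L : (ℕ → Set X) → ℕ → List (Set X) := fun V n => List.ofFn fun i : Fin n => V i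
  have hL : ∀ {U V : ℕ → Set X} {n : ℕ}, (∀ i < n, U i = V i) → L U n = L V n :=
    fun huv => by simp only [L]; congr 1; funext i; exact huv i i.2
  -- The closure of `E V n` contains TWO's first `n` answers. As it depends only on `V 0, …, V (n -
  -- 1)`, ONE may use it for move `n`.
  let E : (ℕ → Set X) → ℕ → Set X := fun V n => {x} ∪ ⋃ i : Fin n, D (L V (i + 1))
  have hE : ∀ V n, IsSigmaPseudocompact (E V n) := fun V n =>
    (IsSigmaPseudocompact.singleton x).union (.iUnion fun i => hD _)
  have hxE : ∀ V n, (E V n).Nonempty := fun V n => ⟨x, .inl rfl⟩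
  have hEcongr : ∀ {U V : ℕ → Set X} {n : ℕ}, (∀ i < n, U i = V i) → E U n = E V n := by
    intro U V n huv
    have : ∀ i : Fin n, L U (i + 1) = L V (i + 1) := fun i =>
      hL fun k hk => huv k (by have := i.2; omega)
    simp only [E, this]
  have hEmono : ∀ V, Monotone (E V) := fun V a b hab => union_subset_union_right _ <|
    iUnion_subset fun i => subset_iUnion_of_subset (Fin.castLE hab i) subset_rfl
  choose! η hη𝒴 hηg using hηex
  obtain ⟨V, hV⟩ := exists_seq_of_forall_dependent
    (fun n (U : ℕ → Set X) W => W = {y | ∀ i ≤ n, ∀ j ≤ n,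
      |η (E U i) j y - η (E U i) j x| < 1 / ((n : ℝ) + 1)})
    (fun n U => ⟨_, rfl⟩)
    (by
      rintro n u v _ huv rfl
      ext y
      refine forall₂_congr fun i hi => ?_
      rw [hEcongr fun k hk => huv k (hk.trans_le hi)])
  have hη𝒴' : ∀ i j, η (E V i) j ∈ 𝒴 := fun i j => hη𝒴 _ (hE V i) (hxE V i) j
  obtain ⟨hlegal, y, hyS, hyV⟩ := hσ V fun n => by
    rw [hV n]
    constructor
    · have : {y | ∀ i ≤ n, ∀ j ≤ n, |η (E V i) j y - η (E V i) j x| < 1 / ((n : ℝ) + 1)} =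
          ⋂ i ∈ Iic n, ⋂ j ∈ Iic n,
            {y | |η (E V i) j y - η (E V i) j x| < 1 / ((n : ℝ) + 1)} := by
        ext y; simp
      rw [this]
      exact (finite_Iic n).isOpen_biInter fun i _ => (finite_Iic n).isOpen_biInter fun j _ =>
        isOpen_lt ((hcont _ (hη𝒴' i j)).sub continuous_const).abs continuous_const
    · intro i _ j _
      rw [sub_self, abs_zero]
      positivity
  have hyx : ∀ i j, η (E V i) j y = η (E V i) j x := by
    intro i j
    have hle : ∀ᶠ n : ℕ in atTop,
        |η (E V i) j y - η (E V i) j x| ≤ 1 / ((n : ℝ) + 1) := by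
      filter_upwards [eventually_ge_atTop i, eventually_ge_atTop j] with n hi hj
      have := mem_iInter.1 hyV n
      rw [hV n] at this
      exact (this i hi j hj).le
    have := ge_of_tendsto tendsto_one_div_add_atTop_nhds_zero_nat hle
    exact sub_eq_zero.1 (abs_nonpos_iff.1 this)
  let 𝒵 : Set (X → ℝ) := ⋃ i, range (η (E V i))
  have h𝒵 : 𝒵 ⊆ 𝒴 := iUnion_subset fun i => range_subset_iff.2 (hη𝒴' i)
  have hg𝒵 : ApproximatesOn 𝒵 g (⋃ n, E V n) := by
    intro s hs hsE ε hε
    lift s to Finset X using hs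
    obtain ⟨n, hn⟩ :=
      (hEmono V).directed_le.exists_mem_subset_of_finset_subset_biUnion hsE
    obtain ⟨f, hf, hfg⟩ := hηg _ (hE V n) (hxE V n) s s.finite_toSet hn ε hε
    exact ⟨f, mem_iUnion.2 ⟨n, hf⟩, hfg⟩
  have hEσ : IsSigmaPseudocompact (⋃ n, E V n) := .iUnion (hE V)
  obtain ⟨h, φ, hh, hφc, hφ, hφg⟩ := exists_mapClusterPt_eqOn (h𝒴.mono h𝒵)
    (fun f hf => hcont f (h𝒵 hf)) hEσ ⟨x, mem_iUnion.2 ⟨0, .inl rfl⟩⟩ hg𝒵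
  have hφyx : φ y = φ x := hφ.apply_eq_of_forall fun k => by
    obtain ⟨i, j, hij⟩ := mem_iUnion.1 (hh k)
    rw [← hij]
    exact hyx i j
  have hφS : ∀ n, ∀ s ∈ σ.answer V n, φ s = g s := by
    intro n s hs
    -- Adjoining `s` gives a continuous `ψ` equal to `g` also at `s`; `φ` and `ψ` agree on a set
    -- whose closure contains `s`.
    obtain ⟨-, ψ, -, hψc, -, hψg⟩ := exists_mapClusterPt_eqOn h𝒴 hcont
      (hEσ.union (.singleton s)) ⟨s, .inr rfl⟩ (hg _)
    have hsD : s ∈ closure (⋃ n, E V n) := by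
      refine closure_mono ?_ (hσD (L V (n + 1)) (hlegal n).2 hs)
      refine subset_iUnion_of_subset (n + 1) (subset_union_of_subset_right ?_ _)
      exact subset_iUnion_of_subset (Fin.last n) subset_rfl
    have hφψ : EqOn φ ψ (⋃ n, E V n) := fun z hz => (hφg hz).trans (hψg (.inl hz)).symm
    exact (hφψ.closure hφc hψc hsD).trans (hψg (.inr rfl))
  rw [← hφg (mem_iUnion.2 ⟨0, .inl rfl⟩), ← hφyx]
  refine closure_minimal ?_ (hK.preimage hφc) hyS
  refine iUnion_subset fun n s hs => ?_
  rw [mem_preimage, hφS n s hs]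
  exact (hlegal n).1 hs

/-! ### Cluster points and compactness in the product -/

theorem hasContinuousClusterPts_image_of_accPt {X : Type*} [TopologicalSpace X]
    {F : Set (Cp X)} {Y : Set F} (hY : ∀ A ⊆ Y, A.Infinite → ∃ z : F, AccPt z (𝓟 A)) :
    HasContinuousClusterPts ((fun f : F => (f : X → ℝ)) '' Y) := by
  intro h hh
  choose u huY hu using hh
  have hval : Continuous fun f : F => (f : X → ℝ) :=
    continuous_subtype_val.comp continuous_subtype_val
  suffices ∃ z, MapClusterPt z atTop u by
    obtain ⟨z, hz⟩ := this
    refine ⟨z, z.1.2, ?_⟩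
    rw [← funext hu]
    exact MapClusterPt.continuousAt_comp (f := fun f : F => (f : X → ℝ)) hval.continuousAt hz
  by_cases hfin : (range u).Finite
  · obtain ⟨z, -, hz⟩ := hfin.isCompact.exists_mapClusterPt (f := atTop) (u := u)
      (tendsto_principal.2 (.of_forall mem_range_self))
    exact ⟨z, hz⟩
  obtain ⟨z, hz⟩ := hY (range u) (range_subset_iff.2 huY) hfin
  refine ⟨z, mapClusterPt_iff_frequently.2 fun U hU => ?_⟩
  rw [Nat.frequently_atTop_iff_infinite]
  intro hUfin
  -- Points of `F` are closed, so each neighborhood of `z` contains infinitely many values of `u`,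
  -- hence infinitely many indices.
  refine (Set.Infinite.of_accPt (hz.nhds_inter hU)) ((hUfin.image u).subset ?_)
  rintro _ ⟨hfU, n, rfl⟩
  exact ⟨n, hfU, rfl⟩

/-- Unboundedness at a point would give a sequence with no cluster value there, so Tychonoff's
theorem applies to a product of balls. -/
theorem HasContinuousClusterPts.isCompact_closure {X : Type*} [TopologicalSpace X]
    {𝒴 : Set (X → ℝ)} (h𝒴 : HasContinuousClusterPts 𝒴) : IsCompact (closure 𝒴) := by
  have hb : ∀ x, ∃ r, ∀ f ∈ 𝒴, f x ∈ Metric.closedBall (0 : ℝ) r := by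
    intro x
    by_contra! hcon
    choose h hh hx using fun n : ℕ => hcon n
    obtain ⟨φ, -, hφ⟩ := h𝒴 h hh
    have hφx := (hφ.continuousAt_comp (continuous_apply x).continuousAt).frequently
      (Metric.ball_mem_nhds _ one_pos)
    obtain ⟨N, hN⟩ := exists_nat_gt (|φ x| + 1)
    obtain ⟨n, hn, hNn⟩ := (hφx.and_eventually (eventually_ge_atTop N)).exists
    have h1 : (n : ℝ) < |h n x| := by simpa using hx n
    have h2 : |h n x - φ x| < 1 := hn
    have h3 : (N : ℝ) ≤ n := Nat.cast_le.2 hNn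
    have h4 := abs_sub_abs_le_abs_sub (h n x) (φ x)
    linarith
  choose r hr using hb
  have hcomp : IsCompact (pi univ fun x => Metric.closedBall (0 : ℝ) (r x)) :=
    isCompact_univ_pi fun x => isCompact_closedBall _ _
  exact hcomp.closure_of_subset fun f hf x _ => hr x f hf

theorem theorem1p11 {X : Type*} [TopologicalSpace X] [T35Space X]
    (hX : IsAVSpace X (lambdaP X)) (F : Set (Cp X)) (hF : IsCountablyPracompactSpace F) :
    IsCompact (closure F) := by
  obtain ⟨Y, hYd, hY⟩ := hF
  let v : F → X → ℝ := fun f => (f : X → ℝ)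
  have hv : Continuous v := continuous_subtype_val.comp continuous_subtype_val
  have h𝒴 : HasContinuousClusterPts (v '' Y) := hasContinuousClusterPts_image_of_accPt hY
  have hcont : ∀ f ∈ v '' Y, Continuous f := by
    rintro _ ⟨f, -, rfl⟩
    exact f.1.2
  have hlim : ∀ g ∈ closure (v '' Y), Continuous g := by
    intro g hg
    refine continuous_iff_isClosed.2 fun K hK => ?_
    by_contra hnc
    obtain ⟨x, hx, σ, hσ⟩ := hX _ hnc
    exact hx.2 (hσ.apply_mem_of_isClosed h𝒴 hcont (approximatesOn_of_mem_closure hg) hK)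
  have hFY : F ⊆ Subtype.val ⁻¹' closure (v '' Y) := fun f hf =>
    image_closure_subset_closure_image hv ⟨⟨f, hf⟩, hYd _, rfl⟩
  have hcomp : IsCompact ((Subtype.val : Cp X → X → ℝ) ⁻¹' closure (v '' Y)) := by
    refine Topology.IsInducing.subtypeVal.isCompact_preimage' h𝒴.isCompact_closure fun g hg => ?_
    exact ⟨⟨g, hlim g hg⟩, rfl⟩
  exact hcomp.of_isClosed_subset isClosed_closure
    (closure_minimal hFY (isClosed_closure.preimage continuous_subtype_val))
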